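/- Let $r,c\ge 0$ be integers, $n=r+c$, $N=2^n$. For a permutation $\varphi$ of $\{0,1\}^n$ let $\mathsf{Sp}^\varphi:\{0,1\}^r\to\{0,1\}^r$ be the single-round sponge with rate $r$ and capacity $c$: $\mathsf{Sp}^\varphi(x)$ consists of the first $r$ bits of $\varphi(x\,\|\,0^c)$. Let $\mathcal A$ be a quantum algorithm (a finite sequence of arbitrary quantum operations, such as unitary gates and measurements, on a query input register and a query output register of $n$ qubits each and a workspace of arbitrary finite dimension, interleaved with oracle queries, with a final measurement that determines the output). A query applies $|u\rangle|v\rangle\mapsto|u\rangle|v\oplus\varphi(u)\rangle$ or $|u\rangle|v\rangle\mapsto|u\rangle|v\oplus\varphi^{-1}(u)\rangle$; the workspace may decide which of the two, also in superposition. Let $$\epsilon=\Pr_{\substack{x\sim\{0,1\}^r\\ \varphi\sim S_N}}\Big[\mathsf{Sp}^\varphi(x)=\mathsf{Sp}^\varphi(x')\;:\;x'\leftarrow\mathcal A^{\varphi,\varphi^{-1}}\big(1^n,\mathsf{Sp}^\varphi(x)\big)\Big]$$ be its probability of inverting the single-round sponge, where $x$ and the permutation $\varphi$ of $\{0,1\}^n$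 are independent and uniformly random and the probability is also over the measurements of $\mathcal A$. If $\mathcal A$ makes at most $T$ quantum queries in total to $\varphi$ and $\varphi^{-1}$, then $$\epsilon\le\frac{80\,(T+1)^2}{2^{\min(r,c)}}.$$ -/

import Mathlib

open scoped Matrix BigOperators

/-- Bit strings of length `n`; addition is bitwise XOR and `0` is the all-zeros string. -/
abbrev BitString (n : ℕ) : Type := Fin n → ZMod 2

/-- The single-round sponge with rate `r`, capacity `c` and block function `φ`: the first `r` bits
of `φ (x || 0^c)`. -/
def singleRoundSponge {r c : ℕ} (φ : Equiv.Perm (BitString (r + c))) (x : BitString r) :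
    BitString r :=
  fun i => φ (Fin.append x 0) (Fin.castAdd c i)

/-- A quantum channel on the Hilbert space with orthonormal basis `S`, given by Kraus operators
`K₁, …, K_m` with `∑ Kᵢᴴ Kᵢ = 1`. Unitary gates are the case `m = 1`; projective and generalized
measurements (with the outcome recorded in a register, forgotten, or used to control later
operations), and resets of registers, are of this form as well. -/
structure KrausChannel (S : Type*) [Fintype S] [DecidableEq S] where
  numKraus : ℕ
  kraus : Fin numKraus → Matrix S S ℂ
  sum_conjTranspose_mul_self : ∑ i, (kraus i)ᴴ * kraus i = 1

/-- The action `ρ ↦ ∑ Kᵢ ρ Kᵢᴴ` of a channel on density matrices. -/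
def KrausChannel.apply {S : Type*} [Fintype S] [DecidableEq S] (C : KrausChannel S)
    (ρ : Matrix S S ℂ) : Matrix S S ℂ :=
  ∑ i, C.kraus i * ρ * (C.kraus i)ᴴ

/-- Computational basis of the registers of an oracle algorithm: the query input register (`n`
qubits), the query output register (`n` qubits), and a workspace with basis `W`. -/
abbrev RegisterBasis (n : ℕ) (W : Type*) : Type _ := BitString n × BitString n × W

/-- The action of an oracle gate on basis states:
`|x, y, w⟩ ↦ |x, y ⊕ φ x, w⟩` if `dir w = true`, and `|x, y, w⟩ ↦ |x, y ⊕ φ⁻¹ x, w⟩` if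
`dir w = false`. -/
def oracleMap {n : ℕ} {W : Type*} (φ : Equiv.Perm (BitString n)) (dir : W → Bool)
    (s : RegisterBasis n W) : RegisterBasis n W :=
  (s.1, s.2.1 + (if dir s.2.2 then φ s.1 else φ.symm s.1), s.2.2)

/-- The oracle unitary, as a matrix in the computational basis. -/
def oracleUnitary {n : ℕ} {W : Type*} [DecidableEq W] (φ : Equiv.Perm (BitString n))
    (dir : W → Bool) : Matrix (RegisterBasis n W) (RegisterBasis n W) ℂ :=
  Matrix.of fun s t => if s = oracleMap φ dir t then 1 else 0

/-- An instruction of a quantum algorithm with oracle access to a permutation and its inverse.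
The constant functions `dir` are the oracle gates for `φ` and for `φ⁻¹`; a non-constant `dir`
lets the workspace decide (coherently or by earlier measurement outcomes) which of the two oracles
is queried. Either way the instruction is one query. -/
inductive OracleInstruction (n : ℕ) (W : Type*) [Fintype W] [DecidableEq W]
  | channel (C : KrausChannel (RegisterBasis n W))
  | query (dir : W → Bool)

/-- Whether an instruction is an oracle query. -/
def OracleInstruction.isQuery {n : ℕ} {W : Type*} [Fintype W] [DecidableEq W] :
    OracleInstruction n W → Bool
  | .channel _ => false
  | .query _ => true

/-- The action of an instruction on density matrices, when the oracle is `φ`. -/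
def OracleInstruction.apply {n : ℕ} {W : Type*} [Fintype W] [DecidableEq W]
    (φ : Equiv.Perm (BitString n)) :
    OracleInstruction n W → Matrix (RegisterBasis n W) (RegisterBasis n W) ℂ →
      Matrix (RegisterBasis n W) (RegisterBasis n W) ℂ
  | .channel C, ρ => C.apply ρ
  | .query dir, ρ => oracleUnitary φ dir * ρ * (oracleUnitary φ dir)ᴴ

/-- A quantum algorithm with inputs in `I` and outputs in `O` and with oracle access to a
permutation of `n`-bit strings and its inverse: the input is encoded as a computational basis
state, a sequence of instructions is carried out, all registers are measured in the computational
basis, and the output is read off from the result. -/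
structure OracleAlgorithm (n : ℕ) (W : Type*) [Fintype W] [DecidableEq W] (I O : Type*) where
  start : I → RegisterBasis n W
  instructions : List (OracleInstruction n W)
  output : RegisterBasis n W → O

namespace OracleAlgorithm

variable {n : ℕ} {W : Type*} [Fintype W] [DecidableEq W] {I O : Type*}

/-- The total number of queries to the permutation and its inverse. -/
def queryCount (A : OracleAlgorithm n W I O) : ℕ :=
  A.instructions.countP OracleInstruction.isQuery

/-- The density matrix right before the final measurement, with oracle `φ` and input `a`. -/
def finalState (A : OracleAlgorithm n W I O) (φ : Equiv.Perm (BitString n)) (a : I) :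
    Matrix (RegisterBasis n W) (RegisterBasis n W) ℂ :=
  A.instructions.foldl (fun ρ g => g.apply φ ρ) (Matrix.single (A.start a) (A.start a) 1)

/-- The probability that, with oracle `φ` and input `a`, the output has the property `P`. -/
noncomputable def outputProbability (A : OracleAlgorithm n W I O)
    (φ : Equiv.Perm (BitString n)) (a : I) (P : O → Prop) [DecidablePred P] : ℝ :=
  ∑ s with P (A.output s), (A.finalState φ a s s).re

end OracleAlgorithm

/-- The probability that `A` inverts the single-round sponge: for a uniformly random
`x ∈ {0,1}^r` and an independent uniformly random permutation `φ` of `{0,1}^(r+c)`, the algorithm,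
given `Sp^φ(x)` and oracle access to `φ` and `φ⁻¹`, outputs some `x'` with `Sp^φ(x) = Sp^φ(x')`. -/
noncomputable def spongeInversionProbability {r c : ℕ} {W : Type*} [Fintype W] [DecidableEq W]
    (A : OracleAlgorithm (r + c) W (BitString r) (BitString r)) : ℝ :=
  𝔼 φ : Equiv.Perm (BitString (r + c)), 𝔼 x : BitString r,
    A.outputProbability φ (singleRoundSponge φ x)
      (fun x' => singleRoundSponge φ x = singleRoundSponge φ x')

/-! Fix a challenge `y` and let `k` be the number of its preimages under the sponge. A random `x`
produces `y` with probability `k / 2^r`, so the success probability is an average of `k` times the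
probability of outputting some preimage of `y`.

Resampling: for each `x` and `z`, `φ ↦ φ * swap (x‖0) z` is a bijection of permutations, so `φ` may
be replaced by its swapped version and averaged over all `2^(r+c)` points `z`. Then `x` is a
solution exactly when `φ z` begins with `y`, which holds for `2^c` points `z`, and `k` grows by at
most one (`card_mul_sum_solutions_le`).

Hybrid argument: the swapped oracle differs from `φ` at two points in each direction. Hence
outputting `x` with the swapped oracle is at most twice as likely as with `φ`, plus `8q` times the
query mass of the run with `φ` on those points, where `q` counts queries. This reference run does
not depend on `x` and `z`, so summing over both gives `2 * 2^c + 8 * q^2 * (2^c + 2^r)`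
(`sum_probabilityOf_swap_le`). Averaging over `φ` and `y` gives the bound. -/

set_option linter.unusedSectionVars false

/-! ### Purifications and the Frobenius norm -/

section Frobenius

open scoped ComplexOrder

attribute [local instance] Matrix.frobeniusNormedAddCommGroup

variable {S κ : Type*} [Fintype S] [Fintype κ]

theorem frobenius_norm_sq_eq_sum (M : Matrix S κ ℂ) : ‖M‖ ^ 2 = ∑ s, ∑ k, ‖M s k‖ ^ 2 := by
  rw [Matrix.frobenius_norm_def, ← Real.sqrt_eq_rpow, Real.sq_sqrt (by positivity)]
  simp

theorem mul_conjTranspose_diag_re (M : Matrix S κ ℂ) (s : S) :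
    ((M * Mᴴ) s s).re = ∑ k, ‖M s k‖ ^ 2 := by
  simp only [Matrix.mul_apply, Matrix.conjTranspose_apply, Complex.re_sum]
  refine Finset.sum_congr rfl fun k _ => ?_
  rw [Complex.star_def, Complex.mul_conj, Complex.ofReal_re, Complex.normSq_eq_norm_sq]

theorem frobenius_norm_sq_eq_trace (M : Matrix S κ ℂ) : ‖M‖ ^ 2 = (Mᴴ * M).trace.re := by
  rw [Matrix.trace_mul_comm, frobenius_norm_sq_eq_sum, Matrix.trace, Complex.re_sum]
  exact Finset.sum_congr rfl fun s _ => (mul_conjTranspose_diag_re M s).symm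

theorem frobenius_norm_isometry_mul [DecidableEq S] (U : Matrix S S ℂ) (hU : Uᴴ * U = 1)
    (M : Matrix S κ ℂ) : ‖U * M‖ = ‖M‖ := by
  rw [← sq_eq_sq₀ (norm_nonneg _) (norm_nonneg _), frobenius_norm_sq_eq_trace,
    frobenius_norm_sq_eq_trace, Matrix.conjTranspose_mul, Matrix.mul_assoc, ← Matrix.mul_assoc Uᴴ,
    hU, Matrix.one_mul]

namespace KrausChannel

variable [DecidableEq S] (C : KrausChannel S)

/-- The action of a channel on purifications: if `M * Mᴴ` is the density matrix `ρ`, then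
`C.dilate M` is the same for `C.apply ρ`. -/
def dilate (M : Matrix S κ ℂ) : Matrix S (Fin C.numKraus × κ) ℂ :=
  Matrix.of fun s p => (C.kraus p.1 * M) s p.2

theorem dilate_mul_conjTranspose (M : Matrix S κ ℂ) :
    C.dilate M * (C.dilate M)ᴴ = C.apply (M * Mᴴ) := by
  have h : ∀ i, C.kraus i * (M * Mᴴ) * (C.kraus i)ᴴ = C.kraus i * M * (C.kraus i * M)ᴴ := by
    intro i
    rw [Matrix.conjTranspose_mul]
    simp only [Matrix.mul_assoc]
  ext s t
  simp only [apply, h, Matrix.sum_apply]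
  rw [Matrix.mul_apply, Fintype.sum_prod_type]
  rfl

theorem dilate_sub (M M' : Matrix S κ ℂ) : C.dilate M - C.dilate M' = C.dilate (M - M') := by
  ext s p
  simp [dilate, Matrix.mul_sub]

theorem trace_apply (ρ : Matrix S S ℂ) : (C.apply ρ).trace = ρ.trace := by
  simp only [apply, Matrix.trace_sum]
  simp_rw [Matrix.trace_mul_comm (_ * ρ), ← Matrix.mul_assoc]
  rw [← Matrix.trace_sum, ← Finset.sum_mul, C.sum_conjTranspose_mul_self, Matrix.one_mul]

/-- Stacking the Kraus operators gives an isometry, so channels cost nothing in the hybrid argument.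
-/
theorem norm_dilate (M : Matrix S κ ℂ) : ‖C.dilate M‖ = ‖M‖ := by
  rw [← sq_eq_sq₀ (norm_nonneg _) (norm_nonneg _), frobenius_norm_sq_eq_trace,
    frobenius_norm_sq_eq_trace, Matrix.trace_mul_comm, dilate_mul_conjTranspose, trace_apply,
    Matrix.trace_mul_comm]

theorem posSemidef_apply {ρ : Matrix S S ℂ} (hρ : ρ.PosSemidef) : (C.apply ρ).PosSemidef :=
  Matrix.posSemidef_sum _ fun i _ => hρ.mul_mul_conjTranspose_same (C.kraus i)

end KrausChannel

/-! ### Query mass and the hybrid argument -/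

section Oracle

variable {n : ℕ} {W : Type*} [Fintype W] [DecidableEq W]

theorem oracleMap_injective (φ : Equiv.Perm (BitString n)) (dir : W → Bool) :
    Function.Injective (oracleMap φ dir) := by
  rintro ⟨u, v, w⟩ ⟨u', v', w'⟩ h
  simp only [oracleMap, Prod.mk.injEq] at h
  obtain ⟨rfl, h, rfl⟩ := h
  simpa using h

theorem oracleUnitary_conjTranspose_mul_self (φ : Equiv.Perm (BitString n)) (dir : W → Bool) :
    (oracleUnitary φ dir)ᴴ * oracleUnitary φ dir = 1 := by
  ext s t
  simp [Matrix.mul_apply, oracleUnitary, Matrix.one_apply, (oracleMap_injective φ dir).eq_iff,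
    eq_comm]

theorem OracleInstruction.posSemidef_apply (φ : Equiv.Perm (BitString n))
    (g : OracleInstruction n W) {ρ : Matrix (RegisterBasis n W) (RegisterBasis n W) ℂ}
    (hρ : ρ.PosSemidef) : (g.apply φ ρ).PosSemidef := by
  cases g with
  | channel C => exact C.posSemidef_apply hρ
  | query dir => exact hρ.mul_mul_conjTranspose_same _

theorem OracleInstruction.trace_apply (φ : Equiv.Perm (BitString n))
    (g : OracleInstruction n W) (ρ : Matrix (RegisterBasis n W) (RegisterBasis n W) ℂ) :
    (g.apply φ ρ).trace = ρ.trace := by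
  cases g with
  | channel C => exact C.trace_apply ρ
  | query dir =>
    rw [apply, Matrix.trace_mul_comm, ← Matrix.mul_assoc, oracleUnitary_conjTranspose_mul_self,
      Matrix.one_mul]

/-- The density matrix after a list of instructions. -/
def runInstructions (φ : Equiv.Perm (BitString n)) (L : List (OracleInstruction n W))
    (ρ : Matrix (RegisterBasis n W) (RegisterBasis n W) ℂ) :
    Matrix (RegisterBasis n W) (RegisterBasis n W) ℂ :=
  L.foldl (fun ρ g => g.apply φ ρ) ρ

theorem posSemidef_runInstructions (φ : Equiv.Perm (BitString n))
    (L : List (OracleInstruction n W)) :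
    ∀ {ρ : Matrix (RegisterBasis n W) (RegisterBasis n W) ℂ}, ρ.PosSemidef →
      (runInstructions φ L ρ).PosSemidef := by
  induction L with
  | nil => exact fun h => h
  | cons g L ih => exact fun h => ih (g.posSemidef_apply φ h)

theorem trace_runInstructions (φ : Equiv.Perm (BitString n)) (L : List (OracleInstruction n W)) :
    ∀ ρ : Matrix (RegisterBasis n W) (RegisterBasis n W) ℂ,
      (runInstructions φ L ρ).trace = ρ.trace := by
  induction L with
  | nil => exact fun _ => rfl
  | cons g L ih => exact fun ρ => (ih _).trans (g.trace_apply φ ρ)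

/-- The sum over all queries of the expectation of `E`, evaluated at the direction of the query
(`true` for the permutation, `false` for its inverse) and at the point queried, when the
instructions are run with oracle `φ` on `ρ`. -/
def queryMass (φ : Equiv.Perm (BitString n)) (E : Bool → BitString n → ℝ) :
    List (OracleInstruction n W) → Matrix (RegisterBasis n W) (RegisterBasis n W) ℂ → ℝ
  | [], _ => 0
  | .channel C :: L, ρ => queryMass φ E L (C.apply ρ)
  | .query dir :: L, ρ =>
    ∑ t, E (dir t.2.2) t.1 * (ρ t t).re +
      queryMass φ E L (oracleUnitary φ dir * ρ * (oracleUnitary φ dir)ᴴ)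

theorem posSemidef_diag_re_nonneg {S : Type*} [Fintype S] {ρ : Matrix S S ℂ} (hρ : ρ.PosSemidef)
    (t : S) : 0 ≤ (ρ t t).re := by
  classical
  exact (Complex.le_def.1 (hρ.diag_nonneg (i := t))).1

theorem queryMass_nonneg (φ : Equiv.Perm (BitString n)) {E : Bool → BitString n → ℝ}
    (hE : ∀ b u, 0 ≤ E b u) (L : List (OracleInstruction n W)) :
    ∀ {ρ : Matrix (RegisterBasis n W) (RegisterBasis n W) ℂ}, ρ.PosSemidef →
      0 ≤ queryMass φ E L ρ := by
  induction L with
  | nil => exact fun _ => le_rfl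
  | cons g L ih =>
    intro ρ hρ
    have h := ih (g.posSemidef_apply φ hρ)
    cases g with
    | channel C => exact h
    | query dir =>
      exact add_nonneg (Finset.sum_nonneg fun t _ =>
        mul_nonneg (hE _ _) (posSemidef_diag_re_nonneg hρ t)) h

/-- At each query the diagonal of the state is a probability distribution, so the query contributes
at most `B`. -/
theorem sum_queryMass_le (φ : Equiv.Perm (BitString n)) {P : Type*} (s : Finset P)
    (E : P → Bool → BitString n → ℝ) {B : ℝ} (hE : ∀ b u, ∑ p ∈ s, E p b u ≤ B)
    (L : List (OracleInstruction n W)) :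
    ∀ {ρ : Matrix (RegisterBasis n W) (RegisterBasis n W) ℂ}, ρ.PosSemidef → ρ.trace = 1 →
      ∑ p ∈ s, queryMass φ (E p) L ρ ≤ L.countP OracleInstruction.isQuery * B := by
  induction L with
  | nil => intro ρ _ _; simp [queryMass]
  | cons g L ih =>
    intro ρ hρ htr
    have h := ih (g.posSemidef_apply φ hρ) ((g.trace_apply φ ρ).trans htr)
    cases g with
    | channel C =>
      rw [List.countP_cons_of_neg (by simp [OracleInstruction.isQuery])]
      exact h
    | query dir =>
      have h1 : ∑ p ∈ s, ∑ t : RegisterBasis n W, E p (dir t.2.2) t.1 * (ρ t t).re ≤ B := by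
        rw [Finset.sum_comm]
        calc ∑ t : RegisterBasis n W, ∑ p ∈ s, E p (dir t.2.2) t.1 * (ρ t t).re
            ≤ ∑ t : RegisterBasis n W, B * (ρ t t).re := by
              refine Finset.sum_le_sum fun t _ => ?_
              rw [← Finset.sum_mul]
              exact mul_le_mul_of_nonneg_right (hE _ _) (posSemidef_diag_re_nonneg hρ t)
          _ = B * ρ.trace.re := by
              rw [← Finset.mul_sum, Matrix.trace, Complex.re_sum]; rfl
          _ = B := by rw [htr, Complex.one_re, mul_one]
      simp only [queryMass, Finset.sum_add_distrib]
      rw [List.countP_cons_of_pos (by rfl)]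
      push_cast
      have h' : ∑ p ∈ s, queryMass φ (E p) L (oracleUnitary φ dir * ρ * (oracleUnitary φ dir)ᴴ) ≤
        L.countP OracleInstruction.isQuery * B := h
      linarith

theorem oracleUnitary_mul_eq_of_eqOn {κ : Type*} (φ φ' : Equiv.Perm (BitString n)) (dir : W → Bool)
    (M : Matrix (RegisterBasis n W) κ ℂ)
    (h : ∀ t k, oracleMap φ dir t ≠ oracleMap φ' dir t → M t k = 0) :
    oracleUnitary φ dir * M = oracleUnitary φ' dir * M := by
  ext s k
  simp only [Matrix.mul_apply, oracleUnitary, Matrix.of_apply]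
  refine Finset.sum_congr rfl fun t _ => ?_
  by_cases ht : oracleMap φ dir t = oracleMap φ' dir t
  · rw [ht]
  · rw [h t k ht, mul_zero, mul_zero]

/-- Only the rows `P` of `M` on which the oracles disagree matter. Both unitaries preserve `‖P‖`,
whence the factor 2. -/
theorem norm_oracleUnitary_mul_sub_le (φ φ' : Equiv.Perm (BitString n))
    {E : Bool → BitString n → ℝ} (hE : ∀ b u, 0 ≤ E b u)
    (hf : ∀ u, φ u ≠ φ' u → 1 ≤ E true u) (hb : ∀ u, φ.symm u ≠ φ'.symm u → 1 ≤ E false u)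
    (dir : W → Bool) (M : Matrix (RegisterBasis n W) κ ℂ) :
    ‖oracleUnitary φ dir * M - oracleUnitary φ' dir * M‖ ≤
      2 * √(∑ t, E (dir t.2.2) t.1 * ((M * Mᴴ) t t).re) := by
  classical
  let P : Matrix (RegisterBasis n W) κ ℂ :=
    Matrix.of fun t k => if oracleMap φ dir t = oracleMap φ' dir t then 0 else M t k
  have hP : oracleUnitary φ dir * (M - P) = oracleUnitary φ' dir * (M - P) := by
    refine oracleUnitary_mul_eq_of_eqOn φ φ' dir _ fun t k ht => ?_
    simp [P, ht]
  have h1 : oracleUnitary φ dir * M - oracleUnitary φ' dir * M =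
      oracleUnitary φ dir * P - oracleUnitary φ' dir * P := by
    rw [Matrix.mul_sub, Matrix.mul_sub] at hP
    rw [sub_eq_sub_iff_sub_eq_sub]
    exact hP
  have h2 : ‖P‖ ≤ √(∑ t, E (dir t.2.2) t.1 * ((M * Mᴴ) t t).re) := by
    refine Real.le_sqrt_of_sq_le ?_
    rw [frobenius_norm_sq_eq_sum]
    refine Finset.sum_le_sum fun t _ => ?_
    rw [mul_conjTranspose_diag_re]
    by_cases ht : oracleMap φ dir t = oracleMap φ' dir t
    · simp only [P, Matrix.of_apply, if_pos ht, norm_zero]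
      have := hE (dir t.2.2) t.1
      simp only [ne_eq, OfNat.ofNat_ne_zero, not_false_eq_true, zero_pow, Finset.sum_const_zero]
      positivity
    · simp only [P, Matrix.of_apply, if_neg ht]
      refine le_mul_of_one_le_left (by positivity) ?_
      cases hd : dir t.2.2 with
      | true => exact hf _ fun h => ht (by simp [oracleMap, hd, h])
      | false => exact hb _ fun h => ht (by simp [oracleMap, hd, h])
  rw [h1]
  refine (norm_sub_le _ _).trans ?_
  rw [frobenius_norm_isometry_mul _ (oracleUnitary_conjTranspose_mul_self φ dir),
    frobenius_norm_isometry_mul _ (oracleUnitary_conjTranspose_mul_self φ' dir)]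
  linarith

/-- The induction step of Cauchy–Schwarz: a sum of `T` square roots is at most the root of `T` times
the sum. -/
theorem sqrt_add_sqrt_mul_le {a b T : ℝ} (ha : 0 ≤ a) (hb : 0 ≤ b) (hT : 0 ≤ T) :
    √a + √(T * b) ≤ √((T + 1) * (a + b)) := by
  refine Real.le_sqrt_of_sq_le ?_
  rw [Real.sqrt_mul hT]
  have h1 := Real.sq_sqrt ha
  have h2 := Real.sq_sqrt hb
  have h3 := Real.sq_sqrt hT
  nlinarith [sq_nonneg (√T * √a - √b)]

/-- The hybrid argument: two runs with different oracles have purifications whose distance is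
controlled by the query mass of one of the runs on the points where the oracles differ. -/
theorem exists_purifications_norm_sub_le (φ φ' : Equiv.Perm (BitString n))
    {E : Bool → BitString n → ℝ} (hE : ∀ b u, 0 ≤ E b u)
    (hf : ∀ u, φ u ≠ φ' u → 1 ≤ E true u) (hb : ∀ u, φ.symm u ≠ φ'.symm u → 1 ≤ E false u)
    (L : List (OracleInstruction n W)) :
    ∀ (κ : Type) [Fintype κ] (M M' : Matrix (RegisterBasis n W) κ ℂ),
      ∃ (κ' : Type) (_ : Fintype κ') (N N' : Matrix (RegisterBasis n W) κ' ℂ),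
        runInstructions φ L (M * Mᴴ) = N * Nᴴ ∧ runInstructions φ' L (M' * M'ᴴ) = N' * N'ᴴ ∧
        ‖N - N'‖ ≤ ‖M - M'‖ +
          2 * √(L.countP OracleInstruction.isQuery * queryMass φ' E L (M' * M'ᴴ)) := by
  induction L with
  | nil => exact fun κ _ M M' => ⟨κ, ‹_›, M, M', rfl, rfl, by simp⟩
  | cons g L ih =>
    intro κ _ M M'
    cases g with
    | channel C =>
      obtain ⟨κ', _, N, N', h1, h2, h3⟩ := ih _ (C.dilate M) (C.dilate M')
      rw [C.dilate_sub, C.norm_dilate] at h3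
      rw [C.dilate_mul_conjTranspose] at h1 h2 h3
      refine ⟨κ', _, N, N', h1, h2, ?_⟩
      rw [List.countP_cons_of_neg (by simp [OracleInstruction.isQuery])]
      exact h3
    | query dir =>
      have hU : ∀ (ψ : Equiv.Perm (BitString n)) (X : Matrix (RegisterBasis n W) κ ℂ),
          oracleUnitary ψ dir * X * (oracleUnitary ψ dir * X)ᴴ =
            oracleUnitary ψ dir * (X * Xᴴ) * (oracleUnitary ψ dir)ᴴ := by
        intro ψ X
        rw [Matrix.conjTranspose_mul]
        simp only [Matrix.mul_assoc]
      obtain ⟨κ', _, N, N', h1, h2, h3⟩ :=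
        ih _ (oracleUnitary φ dir * M) (oracleUnitary φ' dir * M')
      have h4 : ‖oracleUnitary φ dir * M - oracleUnitary φ' dir * M'‖ ≤
          ‖M - M'‖ + 2 * √(∑ t, E (dir t.2.2) t.1 * ((M' * M'ᴴ) t t).re) := by
        -- Passing through `φ` applied to `M'` charges the error to the run with `φ'` alone.
        refine (norm_sub_le_norm_sub_add_norm_sub _ (oracleUnitary φ dir * M') _).trans ?_
        rw [← Matrix.mul_sub,
          frobenius_norm_isometry_mul _ (oracleUnitary_conjTranspose_mul_self φ dir)]
        gcongr
        exact norm_oracleUnitary_mul_sub_le φ φ' hE hf hb dir M'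
      rw [hU] at h1 h2 h3
      refine ⟨κ', _, N, N', h1, h2, ?_⟩
      have hM : (M' * M'ᴴ).PosSemidef := Matrix.posSemidef_self_mul_conjTranspose M'
      have h5 := sqrt_add_sqrt_mul_le
        (a := ∑ t, E (dir t.2.2) t.1 * ((M' * M'ᴴ) t t).re)
        (b := queryMass φ' E L
          (oracleUnitary φ' dir * (M' * M'ᴴ) * (oracleUnitary φ' dir)ᴴ))
        (T := L.countP OracleInstruction.isQuery)
        (Finset.sum_nonneg fun t _ => mul_nonneg (hE _ _) (posSemidef_diag_re_nonneg hM t))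
        (queryMass_nonneg φ' hE L (hM.mul_mul_conjTranspose_same _)) (by positivity)
      rw [List.countP_cons_of_pos (by rfl)]
      push_cast
      simp only [queryMass]
      linarith

end Oracle

theorem norm_sq_le_two_mul_add (a b : ℂ) : ‖a‖ ^ 2 ≤ 2 * ‖b‖ ^ 2 + 2 * ‖a - b‖ ^ 2 := by
  have h : ‖a‖ ≤ ‖b‖ + ‖a - b‖ := by
    simpa using norm_add_le b (a - b)
  nlinarith [sq_nonneg (‖b‖ - ‖a - b‖), norm_nonneg a]

/-- The factor 2 buys an error quadratic in the distance, hence linear in query mass, which can be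
summed over many oracles. -/
theorem sum_diag_re_le (N N' : Matrix S κ ℂ) (s : Finset S) :
    ∑ t ∈ s, ((N * Nᴴ) t t).re ≤ 2 * ∑ t ∈ s, ((N' * N'ᴴ) t t).re + 2 * ‖N - N'‖ ^ 2 := by
  simp only [mul_conjTranspose_diag_re, frobenius_norm_sq_eq_sum]
  calc ∑ t ∈ s, ∑ k, ‖N t k‖ ^ 2
      ≤ ∑ t ∈ s, ∑ k, (2 * ‖N' t k‖ ^ 2 + 2 * ‖(N - N') t k‖ ^ 2) := by
        gcongr
        exact norm_sq_le_two_mul_add _ _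
    _ = 2 * ∑ t ∈ s, ∑ k, ‖N' t k‖ ^ 2 + 2 * ∑ t ∈ s, ∑ k, ‖(N - N') t k‖ ^ 2 := by
        simp only [Finset.sum_add_distrib, Finset.mul_sum]
    _ ≤ _ := by
        gcongr
        exact Finset.subset_univ s

namespace OracleAlgorithm

variable {n : ℕ} {W I O : Type*} [Fintype W] [DecidableEq W]

theorem single_one_eq_mul_conjTranspose [DecidableEq S] (s : S) :
    Matrix.single s s (1 : ℂ) =
      Matrix.single s () (1 : ℂ) * (Matrix.single s () (1 : ℂ))ᴴ := by
  simp [Matrix.conjTranspose_single]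

theorem posSemidef_single_one [DecidableEq S] (s : S) :
    (Matrix.single s s (1 : ℂ)).PosSemidef := by
  rw [single_one_eq_mul_conjTranspose]
  exact Matrix.posSemidef_self_mul_conjTranspose _

theorem finalState_diag_re_nonneg (A : OracleAlgorithm n W I O) (φ : Equiv.Perm (BitString n))
    (a : I) (s : RegisterBasis n W) : 0 ≤ (A.finalState φ a s s).re :=
  posSemidef_diag_re_nonneg
    (posSemidef_runInstructions φ A.instructions (posSemidef_single_one (A.start a))) s

theorem sum_finalState_diag_re (A : OracleAlgorithm n W I O) (φ : Equiv.Perm (BitString n))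
    (a : I) : ∑ s, (A.finalState φ a s s).re = 1 := by
  have h : (A.finalState φ a).trace = 1 :=
    (trace_runInstructions φ A.instructions _).trans (by simp)
  rw [← Complex.re_sum]
  change (A.finalState φ a).trace.re = 1
  rw [h, Complex.one_re]

theorem sum_finalState_diag_re_le (A : OracleAlgorithm n W I O) (φ φ' : Equiv.Perm (BitString n))
    {E : Bool → BitString n → ℝ} (hE : ∀ b u, 0 ≤ E b u)
    (hf : ∀ u, φ u ≠ φ' u → 1 ≤ E true u) (hb : ∀ u, φ.symm u ≠ φ'.symm u → 1 ≤ E false u)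
    (a : I) (s : Finset (RegisterBasis n W)) :
    ∑ t ∈ s, (A.finalState φ a t t).re ≤ 2 * ∑ t ∈ s, (A.finalState φ' a t t).re +
      8 * (A.queryCount * queryMass φ' E A.instructions
        (Matrix.single (A.start a) (A.start a) 1)) := by
  obtain ⟨κ', _, N, N', h1, h2, h3⟩ := exists_purifications_norm_sub_le φ φ' hE hf hb
    A.instructions Unit (Matrix.single (A.start a) () 1) (Matrix.single (A.start a) () 1)
  rw [← single_one_eq_mul_conjTranspose] at h1 h2 h3
  change A.finalState φ a = _ at h1
  change A.finalState φ' a = _ at h2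
  change _ ≤ _ + 2 * √(A.queryCount * _) at h3
  have h0 : 0 ≤ A.queryCount * queryMass φ' E A.instructions
      (Matrix.single (A.start a) (A.start a) 1) :=
    mul_nonneg (Nat.cast_nonneg _) (queryMass_nonneg φ' hE _ (posSemidef_single_one _))
  rw [sub_self, norm_zero, zero_add] at h3
  rw [h1, h2]
  refine (sum_diag_re_le N N' s).trans ?_
  have h4 := pow_le_pow_left₀ (norm_nonneg _) h3 2
  rw [mul_pow, Real.sq_sqrt h0] at h4
  linarith

end OracleAlgorithm

end Frobenius

/-! ### Resampling a permutation at a solution -/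

section Resampling

variable {X Q : Type*} [Fintype X] [DecidableEq X] [Fintype Q] [DecidableEq Q]

/-- Only the values at `ι x` and `z` change. If `z = ι x'`, then `x'` was already a solution by
`hz`, so only `x` can be new. -/
theorem card_filter_mul_swap_le {ι : X → Q} (hι : Function.Injective ι) (B : Q → Prop)
    [DecidablePred B] (φ : Equiv.Perm Q) (x : X) (z : Q) (hz : B (φ z)) :
    Finset.card {x' | B ((φ * Equiv.swap (ι x) z) (ι x'))} ≤
      Finset.card {x' | B (φ (ι x'))} + 1 := by
  refine (Finset.card_le_card (t := insert x (Finset.univ.filter fun x' => B (φ (ι x')))) fun x' hx' => ?_).trans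
    (Finset.card_insert_le _ _)
  replace hx' : B (φ (Equiv.swap (ι x) z (ι x'))) := (Finset.mem_filter.1 hx').2
  simp only [Finset.mem_filter, Finset.mem_univ, true_and, Finset.mem_insert]
  by_cases h : x' = x
  · exact Or.inl h
  · by_cases h' : ι x' = z
    · exact Or.inr (h' ▸ hz)
    · rw [Equiv.swap_apply_of_ne_of_ne (hι.ne h) h'] at hx'
      exact Or.inr hx'

/-- Resampling a uniformly random permutation at one solution `x` of `B (φ (ι x))`. -/
theorem card_mul_sum_solutions_le {ι : X → Q} (hι : Function.Injective ι) (B : Q → Prop)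
    [DecidablePred B] (a : Equiv.Perm Q → X → ℝ) (ha : ∀ φ x, 0 ≤ a φ x) {b : ℝ}
    (hb : ∀ φ : Equiv.Perm Q, ∑ x, ∑ z with B (φ z), a (φ * Equiv.swap (ι x) z) x ≤ b) :
    Fintype.card Q * ∑ φ : Equiv.Perm Q,
        (Finset.card {x | B (φ (ι x))} : ℝ) * ∑ x with B (φ (ι x)), a φ x ≤
      ∑ φ : Equiv.Perm Q, ((Finset.card {x | B (φ (ι x))} : ℝ) + 1) * b := by
  let F (φ : Equiv.Perm Q) (x : X) : ℝ :=
    if B (φ (ι x)) then (Finset.card {x | B (φ (ι x))} : ℝ) * a φ x else 0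
  have h1 : ∀ x z, ∑ φ, F φ x = ∑ φ, F (φ * Equiv.swap (ι x) z) x := fun x z =>
    (Equiv.sum_comp (Equiv.mulRight (Equiv.swap (ι x) z)) fun φ => F φ x).symm
  calc _ = Fintype.card Q * ∑ φ, ∑ x, F φ x := by
        simp only [F, Finset.mul_sum, Finset.sum_filter, mul_ite, mul_zero]
    -- The factor `Fintype.card Q` becomes a sum over a dummy `z`, which `h1` then makes the swap
    -- point.
    _ = ∑ x, ∑ _z : Q, ∑ φ, F φ x := by
        rw [Finset.sum_comm, Finset.mul_sum]
        simp only [Finset.sum_const, Finset.card_univ, nsmul_eq_mul]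
    _ = ∑ x, ∑ z, ∑ φ, F (φ * Equiv.swap (ι x) z) x :=
        Finset.sum_congr rfl fun x _ => Finset.sum_congr rfl fun z _ => h1 x z
    _ = ∑ x, ∑ φ, ∑ z, F (φ * Equiv.swap (ι x) z) x :=
        Finset.sum_congr rfl fun x _ => Finset.sum_comm
    _ = ∑ φ, ∑ x, ∑ z, F (φ * Equiv.swap (ι x) z) x := Finset.sum_comm
    _ ≤ _ := by
        refine Finset.sum_le_sum fun φ _ => ?_
        refine le_trans ?_ (mul_le_mul_of_nonneg_left (hb φ) (by positivity))
        simp only [Finset.mul_sum, Finset.sum_filter]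
        refine Finset.sum_le_sum fun x _ => Finset.sum_le_sum fun z _ => ?_
        by_cases hz : B (φ z)
        · simp only [F, Equiv.Perm.mul_apply, Equiv.swap_apply_left, hz, if_true]
          refine mul_le_mul_of_nonneg_right ?_ (ha _ _)
          exact_mod_cast card_filter_mul_swap_le hι B φ x z hz
        · simp [F, Equiv.Perm.mul_apply, hz]

/-- A point `u` equals `f x` for at most one `x`, leaving `z` free, and `g z` for at most one `z`,
leaving `x` free. -/
theorem sum_product_indicator_le {f : X → Q} (hf : Function.Injective f) {g : Q → Q}
    (hg : Function.Injective g) (Z : Finset Q) (u : Q) :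
    ∑ p ∈ Finset.univ ×ˢ Z, ((if u = f p.1 then 1 else 0) + (if u = g p.2 then 1 else 0) : ℝ) ≤
      Z.card + Fintype.card X := by
  have h1 : ∑ x : X, (if u = f x then 1 else 0 : ℝ) ≤ 1 := by
    rw [Finset.sum_boole]
    exact_mod_cast Finset.card_le_one.2 fun x hx x' hx' => by
      simp only [Finset.mem_filter] at hx hx'
      exact hf (hx.2.symm.trans hx'.2)
  have h2 : ∑ z ∈ Z, (if u = g z then 1 else 0 : ℝ) ≤ 1 := by
    rw [Finset.sum_boole]
    exact_mod_cast Finset.card_le_one.2 fun x hx x' hx' => by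
      simp only [Finset.mem_filter] at hx hx'
      exact hg (hx.2.symm.trans hx'.2)
  rw [Finset.sum_add_distrib, Finset.sum_product_right, Finset.sum_product]
  refine add_le_add ((Finset.sum_le_card_nsmul _ _ _ fun z _ => h1).trans_eq ?_)
    ((Finset.sum_le_card_nsmul _ _ _ fun x _ => h2).trans_eq ?_)
  · rw [nsmul_one]
  · rw [nsmul_one, Finset.card_univ]

end Resampling

/-! ### Output probabilities under resampling -/

namespace OracleAlgorithm

variable {n : ℕ} {W I O : Type*} [Fintype W] [DecidableEq W] [Fintype O] [DecidableEq O]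

/-- The probability that the output is `o`. -/
noncomputable def probabilityOf (A : OracleAlgorithm n W I O) (φ : Equiv.Perm (BitString n))
    (a : I) (o : O) : ℝ :=
  ∑ s with A.output s = o, (A.finalState φ a s s).re

theorem probabilityOf_nonneg (A : OracleAlgorithm n W I O) (φ : Equiv.Perm (BitString n))
    (a : I) (o : O) : 0 ≤ A.probabilityOf φ a o :=
  Finset.sum_nonneg fun s _ => A.finalState_diag_re_nonneg φ a s

theorem outputProbability_eq_sum (A : OracleAlgorithm n W I O) (φ : Equiv.Perm (BitString n))
    (a : I) (P : O → Prop) [DecidablePred P] :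
    A.outputProbability φ a P = ∑ o with P o, A.probabilityOf φ a o := by
  simp only [outputProbability, probabilityOf, Finset.sum_filter]
  simp only [← Finset.sum_filter]
  rw [← Finset.sum_fiberwise_of_maps_to (t := Finset.univ.filter P) (g := A.output)
    fun s hs => by simpa using hs]
  refine Finset.sum_congr rfl fun o ho => Finset.sum_congr ?_ fun _ _ => rfl
  ext s
  simp only [Finset.mem_filter, Finset.mem_univ, true_and] at ho ⊢
  exact and_iff_right_of_imp fun h => h ▸ ho

theorem sum_probabilityOf (A : OracleAlgorithm n W I O) (φ : Equiv.Perm (BitString n)) (a : I) :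
    ∑ o, A.probabilityOf φ a o = 1 := by
  rw [← A.sum_finalState_diag_re φ a]
  exact Finset.sum_fiberwise _ _ _

theorem sum_probabilityOf_swap_le (A : OracleAlgorithm n W I O) {ι : O → BitString n}
    (hι : Function.Injective ι) (φ : Equiv.Perm (BitString n)) (a : I)
    (Z : Finset (BitString n)) :
    ∑ x, ∑ z ∈ Z, A.probabilityOf (φ * Equiv.swap (ι x) z) a x ≤
      2 * Z.card + 8 * (A.queryCount * (A.queryCount * (Z.card + Fintype.card O))) := by
  -- Swapping at `ι x` and `z` changes `φ` only at these points and its inverse only at their images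
  -- under `φ`.
  let E (p : O × BitString n) (b : Bool) (u : BitString n) : ℝ :=
    if b then (if u = ι p.1 then 1 else 0) + (if u = p.2 then 1 else 0)
    else (if u = φ (ι p.1) then 1 else 0) + (if u = φ p.2 then 1 else 0)
  have hE : ∀ p b u, 0 ≤ E p b u := by
    intro p b u
    simp only [E]
    split_ifs <;> norm_num
  have hf : ∀ (p : O × BitString n) (u : BitString n),
      (φ * Equiv.swap (ι p.1) p.2) u ≠ φ u → 1 ≤ E p true u := by
    intro p u hu
    by_cases h1 : u = ι p.1
    · simp only [E, if_true, if_pos h1]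
      exact le_add_of_nonneg_right (by positivity)
    · by_cases h2 : u = p.2
      · simp only [E, if_true, if_pos h2]
        exact le_add_of_nonneg_left (by positivity)
      · exact absurd (by rw [Equiv.Perm.mul_apply, Equiv.swap_apply_of_ne_of_ne h1 h2]) hu
  have hb : ∀ (p : O × BitString n) (u : BitString n),
      (φ * Equiv.swap (ι p.1) p.2).symm u ≠ φ.symm u → 1 ≤ E p false u := by
    intro p u hu
    by_cases h1 : u = φ (ι p.1)
    · simp only [E, if_pos h1, Bool.false_eq_true, if_false]
      exact le_add_of_nonneg_right (by positivity)
    · by_cases h2 : u = φ p.2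
      · simp only [E, if_pos h2, Bool.false_eq_true, if_false]
        exact le_add_of_nonneg_left (by positivity)
      · refine absurd ?_ hu
        rw [Equiv.symm_apply_eq, Equiv.Perm.mul_apply, Equiv.swap_apply_of_ne_of_ne,
          Equiv.apply_symm_apply]
        · exact fun h => h1 ((Equiv.symm_apply_eq φ).1 h)
        · exact fun h => h2 ((Equiv.symm_apply_eq φ).1 h)
  have hsum : ∀ b u, ∑ p ∈ Finset.univ ×ˢ Z, E p b u ≤ Z.card + Fintype.card O := by
    intro b u
    cases b with
    | true => exact sum_product_indicator_le hι Function.injective_id Z u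
    | false => exact sum_product_indicator_le (φ.injective.comp hι) φ.injective Z u
  have hmass := sum_queryMass_le φ (Finset.univ ×ˢ Z) E hsum A.instructions
    (posSemidef_single_one (A.start a)) (by simp)
  have hq : (A.instructions.countP OracleInstruction.isQuery : ℝ) = A.queryCount := rfl
  rw [hq] at hmass
  rw [← Finset.sum_product' (f := fun x z => A.probabilityOf (φ * Equiv.swap (ι x) z) a x)]
  calc _ ≤ ∑ p ∈ Finset.univ ×ˢ Z, (2 * A.probabilityOf φ a p.1 +
        8 * (A.queryCount * queryMass φ (E p) A.instructions
          (Matrix.single (A.start a) (A.start a) 1))) :=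
        Finset.sum_le_sum fun p _ =>
          A.sum_finalState_diag_re_le _ φ (hE p) (hf p) (hb p) a _
    _ = 2 * Z.card + 8 * (A.queryCount * ∑ p ∈ Finset.univ ×ˢ Z, queryMass φ (E p) A.instructions
          (Matrix.single (A.start a) (A.start a) 1)) := by
        rw [Finset.sum_add_distrib, Finset.sum_product_right]
        simp only [← Finset.mul_sum, sum_probabilityOf, Finset.sum_const, nsmul_eq_mul]
        ring
    _ ≤ _ := by gcongr

end OracleAlgorithm

/-! ### Application to the sponge -/

theorem append_zero_injective (r c : ℕ) :
    Function.Injective fun x : BitString r => (Fin.append x 0 : BitString (r + c)) := by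
  intro x x' h
  ext i
  have := congrFun h (Fin.castAdd c i)
  simpa using this

theorem card_filter_castAdd_eq (r c : ℕ) (φ : Equiv.Perm (BitString (r + c))) (y : BitString r) :
    Finset.card {z | (fun i => φ z (Fin.castAdd c i)) = y} = 2 ^ c := by
  have h : Fintype.card (BitString c) = 2 ^ c := by simp [BitString]
  rw [← h, ← Finset.card_univ]
  symm
  refine Finset.card_bij' (fun w _ => φ.symm (Fin.append y w)) (fun z _ j => φ z (Fin.natAdd r j))
    ?_ ?_ ?_ ?_
  · intro w _
    simp
  · simp
  · intro w _
    simp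
  · intro z hz
    simp only [Finset.mem_filter, Finset.mem_univ, true_and] at hz
    rw [Equiv.symm_apply_eq, ← hz]
    exact Fin.append_castAdd_natAdd

theorem two_pow_mul_sum_sponge_le {r c : ℕ} {W : Type*} [Fintype W] [DecidableEq W]
    (A : OracleAlgorithm (r + c) W (BitString r) (BitString r)) (y : BitString r) :
    (2 : ℝ) ^ (r + c) * ∑ φ : Equiv.Perm (BitString (r + c)),
        (Finset.card {x | singleRoundSponge φ x = y} : ℝ) *
          ∑ x with singleRoundSponge φ x = y, A.probabilityOf φ y x ≤
      ∑ φ : Equiv.Perm (BitString (r + c)), ((Finset.card {x | singleRoundSponge φ x = y} : ℝ) + 1) *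
        (2 * 2 ^ c + 8 * (A.queryCount * (A.queryCount * (2 ^ c + 2 ^ r)))) := by
  have h := card_mul_sum_solutions_le (append_zero_injective r c)
    (fun v => (fun i => v (Fin.castAdd c i)) = y) (fun φ x => A.probabilityOf φ y x)
    (fun φ x => A.probabilityOf_nonneg φ y x)
    (b := 2 * 2 ^ c + 8 * (A.queryCount * (A.queryCount * (2 ^ c + 2 ^ r)))) fun φ =>
      (A.sum_probabilityOf_swap_le (append_zero_injective r c) φ y _).trans_eq (by
        rw [card_filter_castAdd_eq]
        simp)
  have hQ : (Fintype.card (BitString (r + c)) : ℝ) = 2 ^ (r + c) := by simp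
  rw [hQ] at h
  exact h

/-- The algorithm sees `x` only through `y`. Grouping by `y` fixes the challenge, so resampling `φ`
leaves the input unchanged. -/
theorem sum_outputProbability_singleRoundSponge {r c : ℕ} {W : Type*} [Fintype W] [DecidableEq W]
    (A : OracleAlgorithm (r + c) W (BitString r) (BitString r))
    (φ : Equiv.Perm (BitString (r + c))) :
    ∑ x, A.outputProbability φ (singleRoundSponge φ x)
        (fun x' => singleRoundSponge φ x = singleRoundSponge φ x') =
      ∑ y, (Finset.card {x | singleRoundSponge φ x = y} : ℝ) *
        ∑ x with singleRoundSponge φ x = y, A.probabilityOf φ y x := by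
  rw [← Finset.sum_fiberwise _ (singleRoundSponge φ)]
  refine Finset.sum_congr rfl fun y _ => ?_
  rw [← nsmul_eq_mul, ← Finset.sum_const]
  refine Finset.sum_congr rfl fun x hx => ?_
  obtain rfl := (Finset.mem_filter.1 hx).2
  rw [A.outputProbability_eq_sum]
  exact Finset.sum_congr (Finset.filter_congr fun _ _ => eq_comm) fun _ _ => rfl

theorem sum_card_singleRoundSponge_fiber {r c : ℕ} (φ : Equiv.Perm (BitString (r + c))) :
    ∑ y, (Finset.card {x | singleRoundSponge φ x = y} : ℝ) = 2 ^ r := by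
  have h := Finset.card_eq_sum_card_fiberwise (s := Finset.univ) (t := Finset.univ)
    (f := singleRoundSponge φ) fun _ _ => Finset.mem_coe.2 (Finset.mem_univ _)
  rw [← Nat.cast_sum, ← h]
  simp

theorem spongeInversionProbability_le {r c : ℕ} {W : Type*} [Fintype W] [DecidableEq W]
    (A : OracleAlgorithm (r + c) W (BitString r) (BitString r)) :
    spongeInversionProbability A ≤
      (4 * 2 ^ c + 16 * (A.queryCount : ℝ) ^ 2 * (2 ^ c + 2 ^ r)) / 2 ^ (r + c) := by
  have hR : (Fintype.card (BitString r) : ℝ) = 2 ^ r := by simp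
  have hΦ : (0 : ℝ) < Fintype.card (Equiv.Perm (BitString (r + c))) :=
    Nat.cast_pos.2 Fintype.card_pos
  have h := Finset.sum_le_sum fun (y : BitString r) (_ : y ∈ Finset.univ) =>
    two_pow_mul_sum_sponge_le A y
  rw [← Finset.mul_sum, Finset.sum_comm, Finset.sum_comm (s := Finset.univ (α := BitString r))] at h
  -- Fibre sizes sum to `2^r` over `y`, and so do the extra ones: this doubles the per-challenge
  -- bound and cancels the average over `x`.
  simp only [← sum_outputProbability_singleRoundSponge, ← Finset.sum_mul, Finset.sum_add_distrib,
    sum_card_singleRoundSponge_fiber, Finset.sum_const, Finset.card_univ, nsmul_eq_mul, mul_one,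
    hR] at h
  simp only [spongeInversionProbability, Fintype.expect_eq_sum_div_card, hR]
  rw [← Finset.sum_div, div_div, div_le_div_iff₀ (by positivity) (by positivity), mul_comm]
  refine h.trans_eq ?_
  ring

theorem mainTheorem3 (r c T : ℕ) {W : Type*} [Fintype W] [DecidableEq W]
    (A : OracleAlgorithm (r + c) W (BitString r) (BitString r)) (hT : A.queryCount ≤ T)
    (ε : ℝ) (hε : spongeInversionProbability A = ε) :
    ε ≤ 80 * ((T : ℝ) + 1) ^ 2 / 2 ^ min r c := by
  have hq : (A.queryCount : ℝ) ≤ T := by exact_mod_cast hT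
  have h1 : (2 : ℝ) ^ c * 2 ^ min r c ≤ 2 ^ (r + c) := by
    rw [← pow_add]
    exact pow_le_pow_right₀ one_le_two (by omega)
  have h2 : (2 : ℝ) ^ r * 2 ^ min r c ≤ 2 ^ (r + c) := by
    rw [← pow_add]
    exact pow_le_pow_right₀ one_le_two (by omega)
  rw [← hε]
  refine (spongeInversionProbability_le A).trans ?_
  rw [div_le_div_iff₀ (by positivity) (by positivity)]
  calc (4 * 2 ^ c + 16 * (A.queryCount : ℝ) ^ 2 * (2 ^ c + 2 ^ r)) * 2 ^ min r c
      = 4 * (2 ^ c * 2 ^ min r c) + 16 * (A.queryCount : ℝ) ^ 2 *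
          (2 ^ c * 2 ^ min r c + 2 ^ r * 2 ^ min r c) := by ring
    _ ≤ 4 * 2 ^ (r + c) + 16 * (T : ℝ) ^ 2 * (2 ^ (r + c) + 2 ^ (r + c)) := by gcongr
    _ = (4 + 32 * (T : ℝ) ^ 2) * 2 ^ (r + c) := by ring
    -- The constant has slack: `4 + 32 * T^2` is already below `32 * (T + 1)^2`.
    _ ≤ 80 * ((T : ℝ) + 1) ^ 2 * 2 ^ (r + c) := by
        gcongr
        nlinarith [(Nat.cast_nonneg T : (0 : ℝ) ≤ T)]
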